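/- Let $K\ge 1$ and let $I_1,\dots,I_K$ be finite index sets. A $K$-array is a map $I_1\times\cdots\times I_K\to\mathbb R$. For a $K$-array $M$ and matrices $\Sigma_k\in\mathbb R^{I_k\times I_k}$, a random $K$-array $Y$ is called array normal, $Y\sim\mathrm{anorm}(M,\Sigma_1\circ\cdots\circ\Sigma_K)$, if there are nonsingular matrices $A_k\in\mathbb R^{I_k\times I_k}$ with $\Sigma_k=A_kA_k^T$ for all $k$ such that $Y$ has the law of $M+Z\times\{A_1,\dots,A_K\}$, where $Z$ is a $K$-array of independent standard normal entries and $$(Z\times\{A_1,\dots,A_K\})_{i_1,\dots,i_K}=\sum_{j_1,\dots,j_K}\Big(\prod_{k=1}^K (A_k)_{i_k,j_k}\Big)Z_{j_1,\dots,j_K}.$$ The outer product is $(\Sigma_1\circ\cdots\circ\Sigma_K)_{i,j}=\prod_{k=1}^K(\Sigma_k)_{i_k,j_k}$. For $a\subseteq I_1$ the slice $Y_a$ is the array $\{y_{i_1,\dots,i_K}: i_1\in a\}$; $\Sigma_{1[b,a]}$ is the submatrix of $\Sigma_1$ with rows in $b$ and columns in $a$; and the mode-one product is $(W\times_1 B)_{i_1,i_2,\dots,i_K}=\sum_j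 B_{i_1,j}W_{j,i_2,\dots,i_K}$. Let $Y\sim\mathrm{anorm}(M,\Sigma_1\circ\cdots\circ\Sigma_K)$ and let $a,b\subseteq I_1$ be disjoint. Put $$M_{b|a}(y)=M_b+(y-M_a)\times_1\big(\Sigma_{1[b,a]}(\Sigma_{1[a,a]})^{-1}\big),\qquad \Sigma_{1,b|a}=\Sigma_{1[b,b]}-\Sigma_{1[b,a]}(\Sigma_{1[a,a]})^{-1}\Sigma_{1[a,b]}.$$ Then for almost every $y$ with respect to the law of $Y_a$, the conditional distribution of $Y_b$ given $Y_a=y$ is $\mathrm{anorm}\big(M_{b|a}(y),\,\Sigma_{1,b|a}\circ\Sigma_2\circ\cdots\circ\Sigma_K\big)$. Moreover, this conditional distribution has square-integrable entries, its mean array is $M_{b|a}(y)$, and the covariance of its entries $i$ and $j$ is $(\Sigma_{1,b|a}\circ\Sigma_2\circ\cdots\circ\Sigma_K)_{i,j}$. -/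

import Mathlib

open MeasureTheory ProbabilityTheory

universe u

/-- A real `K`-array with index sets `I 0, …, I (K - 1)`: a map from the product of the index
sets to the real numbers. -/
abbrev KArray {K : ℕ} (I : Fin K → Type u) : Type u := (∀ k, I k) → ℝ

/-- The Tucker product `Z × {A 0, …, A (K - 1)} = Z ×₁ A 0 ×₂ ⋯`, entry by entry. -/
def tucker {K : ℕ} {I J : Fin K → Type u} [∀ k, Fintype (I k)]
    (Z : KArray I) (A : ∀ k, Matrix (J k) (I k) ℝ) : KArray J :=
  fun i => ∑ j : (∀ k, I k), (∏ k, A k (i k) (j k)) * Z j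

/-- The outer product `S 0 ∘ ⋯ ∘ S (K - 1)` of square matrices: its entry at `(i, j)` is
`∏ k, S k (i k) (j k)`. -/
def outerProd {K : ℕ} {I : Fin K → Type u} (S : ∀ k, Matrix (I k) (I k) ℝ)
    (i j : ∀ k, I k) : ℝ :=
  ∏ k, S k (i k) (j k)

/-- The law of a `K`-array of independent standard normal entries. -/
noncomputable def stdArrayNormal {K : ℕ} (I : Fin K → Type u) [∀ k, Fintype (I k)] :
    Measure (KArray I) :=
  Measure.pi fun _ => gaussianReal 0 1

/-- `ν` is the array normal law `anorm(M, S 0 ∘ ⋯ ∘ S (K - 1))`: the law of `M + Z × A`, where `Z`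
is an array of independent standard normal entries and `A` is a list of nonsingular matrices with
`S k = A k (A k)ᵀ` for every mode `k`. -/
def IsArrayNormal {K : ℕ} {I : Fin K → Type u} [∀ k, Fintype (I k)] [∀ k, DecidableEq (I k)]
    (ν : Measure (KArray I)) (M : KArray I) (S : ∀ k, Matrix (I k) (I k) ℝ) : Prop :=
  ∃ A : ∀ k, Matrix (I k) (I k) ℝ,
    (∀ k, IsUnit (A k)) ∧ (∀ k, S k = A k * (A k).transpose) ∧
      ν = (stdArrayNormal I).map fun Z => M + tucker Z A

/-- The index sets `α, I 1, …, I K` obtained from `I 0, I 1, …, I K` by replacing the index set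
of the first mode by `α`. -/
def ReplaceFirst {K : ℕ} (I : Fin (K + 1) → Type u) (α : Type u) : Fin (K + 1) → Type u :=
  Fin.cons α fun k => I k.succ

instance ReplaceFirst.instFintype {K : ℕ} (I : Fin (K + 1) → Type u) (α : Type u)
    [hI : ∀ k, Fintype (I k)] [hα : Fintype α] (k : Fin (K + 1)) :
    Fintype (ReplaceFirst I α k) :=
  Fin.cases (motive := fun k => Fintype (ReplaceFirst I α k)) hα (fun k => hI k.succ) k

instance ReplaceFirst.instDecidableEq {K : ℕ} (I : Fin (K + 1) → Type u) (α : Type u)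
    [hI : ∀ k, DecidableEq (I k)] [hα : DecidableEq α] (k : Fin (K + 1)) :
    DecidableEq (ReplaceFirst I α k) :=
  Fin.cases (motive := fun k => DecidableEq (ReplaceFirst I α k)) hα (fun k => hI k.succ) k

/-- The multi-index `(x, i 1, …, i K)`: the first entry of `i` is replaced by `x`. -/
def replaceFirstIdx {K : ℕ} {I : Fin (K + 1) → Type u} {α β : Type u}
    (x : β) (i : ∀ k, ReplaceFirst I α k) : ∀ k, ReplaceFirst I β k :=
  Fin.cons (α := ReplaceFirst I β) x fun k => i k.succ

/-- The list `T, S 1, …, S K` of square matrices. -/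
def replaceFirstMatrix {K : ℕ} {I : Fin (K + 1) → Type u} {α : Type u}
    (T : Matrix α α ℝ) (S : ∀ k, Matrix (I k) (I k) ℝ) :
    ∀ k, Matrix (ReplaceFirst I α k) (ReplaceFirst I α k) ℝ :=
  Fin.cons (α := fun k => Matrix (ReplaceFirst I α k) (ReplaceFirst I α k) ℝ) T
    fun k => S k.succ

/-- The slice `Y_a = {y_{i_1, …, i_K} : i_1 ∈ a}` of an array along the first mode. -/
def slice {K : ℕ} {I : Fin (K + 1) → Type u} (a : Finset (I 0)) (Y : KArray I) :
    KArray (ReplaceFirst I a) :=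
  fun i => Y (Fin.cons (α := I) (i 0 : a).1 fun k => i k.succ)

/-- The mode-one product `Z ×₁ A`. -/
def modeOneProd {K : ℕ} {I : Fin (K + 1) → Type u} {α β : Type u} [Fintype α]
    (Z : KArray (ReplaceFirst I α)) (A : Matrix β α ℝ) : KArray (ReplaceFirst I β) :=
  fun i => ∑ j : α, A (i 0 : β) j * Z (replaceFirstIdx j i)

/-- The submatrix `S_[b,a]` with rows in `b` and columns in `a`. -/
def block {α : Type u} (S : Matrix α α ℝ) (b a : Finset α) : Matrix b a ℝ :=
  S.submatrix Subtype.val Subtype.val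

/-- The conditional mean `M_b + (y - M_a) ×₁ (S_[b,a] S_[a,a]⁻¹)`, with `S` the covariance matrix
of the first mode. -/
noncomputable def condMean {K : ℕ} {I : Fin (K + 1) → Type u} [DecidableEq (I 0)]
    (M : KArray I) (S : Matrix (I 0) (I 0) ℝ) (a b : Finset (I 0))
    (y : KArray (ReplaceFirst I a)) : KArray (ReplaceFirst I b) :=
  slice b M + modeOneProd (y - slice a M) (block S b a * (block S a a)⁻¹)

/-- The conditional covariance `S_[b,b] - S_[b,a] S_[a,a]⁻¹ S_[a,b]`. -/
noncomputable def condCov {α : Type u} [DecidableEq α] (S : Matrix α α ℝ) (a b : Finset α) :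
    Matrix b b ℝ :=
  block S b b - block S b a * (block S a a)⁻¹ * block S a b

/-! This is Gaussian regression, carried through Kronecker products. Put `B = S_[b,a] S_[a,a]⁻¹` in
the first mode, and factor `S_[a,a] = T Tᵀ` and the Schur complement `condCov = C Cᵀ`. With
independent standard arrays `u`, `v`, the pair of slices has the law of `Y_a = M_a + u × {T, A 1,
…}`, `Y_b = condMean (Y_a) + v × {C, A 1, …}`. Both sides are Gaussian with equal means, and their
covariances agree because Kronecker products multiply mode by mode and are additive in the first
factor (`map_slice_eq_regression`).

Since `v` is independent of `Y_a`, freezing `Y_a = y` leaves the law of `condMean y + v × {C, A 1,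
…}` (`condDistrib_ae_eq_map_of_regression`). This is array normal because `C` is nonsingular
(`condCov_posDef`). The moments then hold for every array normal law. -/

theorem Matrix.PosDef.exists_isUnit_eq_mul_transpose {n : Type*} [Fintype n] [DecidableEq n]
    {T : Matrix n n ℝ} (hT : T.PosDef) :
    ∃ A : Matrix n n ℝ, IsUnit A ∧ T = A * A.transpose := by
  -- With the Loewner order and the operator norm, matrices form a C⋆-algebra in which positive
  -- definite means strictly positive.
  open scoped MatrixOrder Matrix.Norms.L2Operator in
  obtain ⟨A, hA, h⟩ :=
    CStarAlgebra.isStrictlyPositive_iff_eq_mul_star_self.1 hT.isStrictlyPositive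
  exact ⟨A, hA, by simpa [Matrix.star_eq_conjTranspose] using h⟩

theorem Matrix.posDef_mul_transpose {n : Type*} [Fintype n] [DecidableEq n]
    {A : Matrix n n ℝ} (hA : IsUnit A) : (A * A.transpose).PosDef := by
  simpa using Matrix.PosDef.mul_conjTranspose_self A (Matrix.vecMul_injective_of_isUnit hA)

/-! ### Blocks and Schur complements of the first-mode covariance. -/

section Block

variable {α : Type u}

theorem block_posDef {S : Matrix α α ℝ} (hS : S.PosDef) (a : Finset α) : (block S a a).PosDef :=
  hS.submatrix Subtype.val_injective

theorem block_transpose {S : Matrix α α ℝ} (hS : S.PosDef) (b a : Finset α) :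
    (block S b a).transpose = block S a b := by
  have h : S.transpose = S := by simpa using hS.isHermitian.eq
  ext i j
  exact congrFun (congrFun h i) j

/-- The regression coefficients `B = S_[b,a] S_[a,a]⁻¹` satisfy `S_[a,a] Bᵀ = S_[a,b]`. -/
theorem block_mul_transpose_regression [DecidableEq α] {S : Matrix α α ℝ} (hS : S.PosDef)
    (a b : Finset α) :
    block S a a * (block S b a * (block S a a)⁻¹).transpose = block S a b := by
  have hu := (Matrix.isUnit_iff_isUnit_det _).1 (block_posDef hS a).isUnit
  rw [Matrix.transpose_mul, Matrix.transpose_nonsing_inv, block_transpose hS, block_transpose hS,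
    ← Matrix.mul_assoc, Matrix.mul_nonsing_inv _ hu, Matrix.one_mul]

variable [Fintype α]

theorem block_mul_transpose (A : Matrix α α ℝ) (b a : Finset α) :
    block (A * A.transpose) b a =
      A.submatrix (Subtype.val : b → α) id *
        (A.submatrix (Subtype.val : a → α) id).transpose := by
  ext i j
  simp [block, Matrix.mul_apply]

variable [DecidableEq α]

theorem block_eq_mul (S : Matrix α α ℝ) (b a : Finset α) :
    block S b a = (1 : Matrix α α ℝ).submatrix (Subtype.val : b → α) id * S *
      ((1 : Matrix α α ℝ).submatrix (Subtype.val : a → α) id).transpose := by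
  ext i j
  simp [block, Matrix.mul_apply, Matrix.one_apply]

/-- The Schur complement is the covariance of the residual `x_b - B x_a`, hence a congruence of `S`
by `Eb - B * Ea`, with `Ea`, `Eb` the coordinate restrictions. It remains to see that the rows of
this matrix are independent. -/
theorem condCov_posDef {S : Matrix α α ℝ} (hS : S.PosDef) {a b : Finset α} (hab : Disjoint a b) :
    (condCov S a b).PosDef := by
  set B := block S b a * (block S a a)⁻¹ with hB
  set Ea := (1 : Matrix α α ℝ).submatrix (Subtype.val : a → α) id with hEa
  set Eb := (1 : Matrix α α ℝ).submatrix (Subtype.val : b → α) id with hEb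
  have key : condCov S a b = (Eb - B * Ea) * S * (Eb - B * Ea).transpose := by
    have h1 := block_mul_transpose_regression hS a b
    have h2 : (Eb - B * Ea) * S * (Eb - B * Ea).transpose =
        block S b b - B * block S a b - (block S b a * B.transpose -
          B * (block S a a * B.transpose)) := by
      simp only [block_eq_mul S, ← hEa, ← hEb, Matrix.transpose_sub, Matrix.transpose_mul,
        Matrix.sub_mul, Matrix.mul_sub, Matrix.mul_assoc]
    have h3 : block S b a * B.transpose = B * block S a b := by
      rw [hB, Matrix.transpose_mul, Matrix.transpose_nonsing_inv, block_transpose hS,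
        block_transpose hS, Matrix.mul_assoc]
    rw [h2, h1, h3, sub_self, sub_zero, condCov]
  have hinj : Function.Injective (Eb - B * Ea).vecMul := by
    intro x y hxy
    -- Disjointness enters here: `Ea` vanishes on the columns in `b`, so these columns form the
    -- identity.
    have hcol : (Eb - B * Ea).submatrix id (Subtype.val : b → α) = 1 := by
      ext i j
      have hj : ∀ k : a, (k : α) ≠ (j : α) := fun k h =>
        Finset.disjoint_left.1 hab k.2 (h ▸ j.2)
      simp [hEa, hEb, Matrix.mul_apply, Matrix.one_apply, hj]
    have h : ∀ z : b → ℝ, (fun j : b => Matrix.vecMul z (Eb - B * Ea) j) = z := by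
      intro z
      calc (fun j : b => Matrix.vecMul z (Eb - B * Ea) j)
          = Matrix.vecMul z ((Eb - B * Ea).submatrix id (Subtype.val : b → α)) := rfl
        _ = z := by rw [hcol, Matrix.vecMul_one]
    rw [← h x, ← h y]
    funext j
    exact congrFun hxy j
  rw [key]
  simpa using hS.mul_mul_conjTranspose_same hinj

end Block

/-! ### Linear images of standard Gaussian vectors. -/

section Gaussian

theorem LinearMap.eq_dotProduct {ι : Type*} [Fintype ι] [DecidableEq ι] (f : (ι → ℝ) →ₗ[ℝ] ℝ)
    (x : ι → ℝ) : f x = (fun i => f (Pi.single i 1)) ⬝ᵥ x := by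
  conv_lhs => rw [pi_eq_sum_univ' x, map_sum]
  simp [dotProduct, mul_comm]

open Matrix in
theorem vecMul_dotProduct_vecMul {α β κ : Type*} [Fintype α] [Fintype β] [Fintype κ]
    (a : α → ℝ) (b : β → ℝ) (X : Matrix α κ ℝ) (Y : Matrix β κ ℝ) :
    (a ᵥ* X) ⬝ᵥ (b ᵥ* Y) = a ⬝ᵥ (X * Yᵀ) *ᵥ b := by
  rw [← mulVec_mulVec, dotProduct_mulVec, mulVec_transpose]

open Matrix in
-- The Gaussian exponent thus depends on `X` and `Y` only through their covariance blocks.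
theorem vecMul_add_vecMul_dotProduct_self {α β κ : Type*} [Fintype α] [Fintype β] [Fintype κ]
    (a : α → ℝ) (b : β → ℝ) (X : Matrix α κ ℝ) (Y : Matrix β κ ℝ) :
    (a ᵥ* X + b ᵥ* Y) ⬝ᵥ (a ᵥ* X + b ᵥ* Y) =
      a ⬝ᵥ (X * Xᵀ) *ᵥ a + 2 * (a ⬝ᵥ (X * Yᵀ) *ᵥ b) + b ⬝ᵥ (Y * Yᵀ) *ᵥ b := by
  rw [add_dotProduct, dotProduct_add, dotProduct_add, dotProduct_comm (b ᵥ* Y) (a ᵥ* X)]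
  simp only [vecMul_dotProduct_vecMul]
  ring

/-- By independence the characteristic function factors over the coordinates, each contributing a
one-dimensional Gaussian factor. -/
theorem charFunDual_map_pi_gaussianReal {ι E : Type*} [Fintype ι] [DecidableEq ι]
    [NormedAddCommGroup E] [NormedSpace ℝ E] [MeasurableSpace E] [BorelSpace E]
    (F : (ι → ℝ) →L[ℝ] E) (L : StrongDual ℝ E) :
    charFunDual ((Measure.pi fun _ : ι => gaussianReal 0 1).map F) L =
      Complex.exp (-((∑ i, L (F (Pi.single i 1)) ^ 2 : ℝ) : ℂ) / 2) := by
  rw [charFunDual_map, charFunDual_pi]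
  have h : ∀ i, charFunDual (gaussianReal 0 1)
      ((L.comp F).comp (ContinuousLinearMap.single ℝ (fun _ : ι => ℝ) i)) =
      Complex.exp (-((L (F (Pi.single i 1)) ^ 2 : ℝ) : ℂ) / 2) := by
    intro i
    set c := L (F (Pi.single i 1)) with hc
    have hL : ∀ v : ℝ, (L.comp F).comp (ContinuousLinearMap.single ℝ (fun _ : ι => ℝ) i) v =
        c * v := by
      intro v
      have hv : (Pi.single i v : ι → ℝ) = v • Pi.single i 1 := by
        rw [← Pi.single_smul, smul_eq_mul, mul_one]
      simp [hv, hc, mul_comm]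
    calc _ = charFun (gaussianReal 0 1) c := by
          rw [charFunDual_apply, charFun_apply_real]
          simp_rw [hL, Complex.ofReal_mul]
      _ = _ := by
          rw [charFun_gaussianReal]
          simp [neg_div]
  rw [Finset.prod_congr rfl fun i _ => h i, ← Complex.exp_sum]
  congr 1
  push_cast
  rw [← Finset.sum_div, Finset.sum_neg_distrib]

open Matrix in
/-- A centred Gaussian pair `(D₁ z, D₂ z)` has the law of the regression model
`(A u, G u + C v)` with independent `u` and `v` as soon as the covariances agree. -/
theorem map_pi_gaussianReal_eq_regression {ι α β : Type*} [Fintype ι] [Fintype α] [Fintype β]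
    [DecidableEq ι] [DecidableEq α] [DecidableEq β]
    (D₁ : Matrix α ι ℝ) (D₂ : Matrix β ι ℝ) (A : Matrix α α ℝ) (G : Matrix β α ℝ)
    (C : Matrix β β ℝ) (h₁₁ : D₁ * D₁ᵀ = A * Aᵀ) (h₁₂ : D₁ * D₂ᵀ = A * Gᵀ)
    (h₂₂ : D₂ * D₂ᵀ = G * Gᵀ + C * Cᵀ) :
    (Measure.pi fun _ : ι => gaussianReal 0 1).map (fun z => (D₁ *ᵥ z, D₂ *ᵥ z)) =
      ((Measure.pi fun _ : α => gaussianReal 0 1).prod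
        (Measure.pi fun _ : β => gaussianReal 0 1)).map
          (fun p => (A *ᵥ p.1, G *ᵥ p.1 + C *ᵥ p.2)) := by
  let F₀ : (ι → ℝ) →L[ℝ] (α → ℝ) × (β → ℝ) :=
    (Matrix.mulVecLin D₁).toContinuousLinearMap.prod (Matrix.mulVecLin D₂).toContinuousLinearMap
  let F₁ : (α → ℝ) →L[ℝ] (α → ℝ) × (β → ℝ) :=
    (Matrix.mulVecLin A).toContinuousLinearMap.prod (Matrix.mulVecLin G).toContinuousLinearMap
  let F₂ : (β → ℝ) →L[ℝ] (α → ℝ) × (β → ℝ) :=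
    (ContinuousLinearMap.inr ℝ (α → ℝ) (β → ℝ)).comp (Matrix.mulVecLin C).toContinuousLinearMap
  have hF₀ : (fun z => (D₁ *ᵥ z, D₂ *ᵥ z)) = F₀ := rfl
  have hF₁₂ : (fun p : (α → ℝ) × (β → ℝ) => (A *ᵥ p.1, G *ᵥ p.1 + C *ᵥ p.2)) =
      F₁.coprod F₂ := by
    funext p
    simp [F₁, F₂]
  rw [hF₀, hF₁₂]
  apply Measure.ext_of_charFunDual
  funext L
  rw [charFunDual_map_pi_gaussianReal, charFunDual_map, charFunDual_prod]
  have e₁ : (L.comp (F₁.coprod F₂)).comp (.inl ℝ _ _) = L.comp F₁ := by ext; simp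
  have e₂ : (L.comp (F₁.coprod F₂)).comp (.inr ℝ _ _) = L.comp F₂ := by ext; simp
  rw [e₁, e₂, ← charFunDual_map, ← charFunDual_map, charFunDual_map_pi_gaussianReal,
    charFunDual_map_pi_gaussianReal, ← Complex.exp_add, ← add_div, ← neg_add]
  norm_cast
  -- Writing `L` as a pair of dot products turns each exponent into a squared norm, which expands
  -- into covariance blocks.
  set a : α → ℝ := fun i => L (Pi.single i 1, 0) with ha
  set b : β → ℝ := fun i => L (0, Pi.single i 1) with hb
  have hL : ∀ x y, L (x, y) = a ⬝ᵥ x + b ⬝ᵥ y := by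
    intro x y
    have h1 : L (x, y) = L (x, 0) + L (0, y) := by rw [← map_add]; simp
    rw [h1]
    exact congrArg₂ (· + ·)
      (LinearMap.eq_dotProduct (L.comp (.inl ℝ (α → ℝ) (β → ℝ))).toLinearMap x)
      (LinearMap.eq_dotProduct (L.comp (.inr ℝ (α → ℝ) (β → ℝ))).toLinearMap y)
  have s₀ : ∑ i, L (F₀ (Pi.single i 1)) ^ 2 =
      (a ᵥ* D₁ + b ᵥ* D₂) ⬝ᵥ (a ᵥ* D₁ + b ᵥ* D₂) :=
    Finset.sum_congr rfl fun i _ => by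
      simp [F₀, hL, sq]
      rfl
  have s₁ : ∑ i, L (F₁ (Pi.single i 1)) ^ 2 =
      (a ᵥ* A + b ᵥ* G) ⬝ᵥ (a ᵥ* A + b ᵥ* G) :=
    Finset.sum_congr rfl fun i _ => by
      simp [F₁, hL, sq]
      rfl
  have s₂ : ∑ i, L (F₂ (Pi.single i 1)) ^ 2 = (b ᵥ* C) ⬝ᵥ (b ᵥ* C) :=
    Finset.sum_congr rfl fun i _ => by
      simp [F₂, hL, sq]
      rfl
  rw [s₀, s₁, s₂, vecMul_add_vecMul_dotProduct_self, vecMul_add_vecMul_dotProduct_self,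
    vecMul_dotProduct_vecMul, h₁₁, h₁₂, h₂₂, add_mulVec, dotProduct_add, ← add_assoc]

end Gaussian

/-! ### Tucker products as Kronecker matrices. -/

section TuckerMatrix

variable {K : ℕ} {I J L : Fin K → Type u}

/-- The Kronecker product of the matrices `A k`, which represents `Z ↦ tucker Z A`. -/
def tuckerMatrix (A : ∀ k, Matrix (J k) (I k) ℝ) : Matrix (∀ k, J k) (∀ k, I k) ℝ :=
  Matrix.of fun i j => ∏ k, A k (i k) (j k)

theorem tucker_eq_mulVec [∀ k, Fintype (I k)] (Z : KArray I) (A : ∀ k, Matrix (J k) (I k) ℝ) :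
    tucker Z A = (tuckerMatrix A).mulVec Z :=
  rfl

theorem aestronglyMeasurable_eval (ν : Measure (KArray I)) (i : ∀ k, I k) :
    AEStronglyMeasurable (fun x : KArray I => x i) ν :=
  (measurable_pi_apply i).aestronglyMeasurable

theorem measurable_tucker [∀ k, Fintype (I k)] (A : ∀ k, Matrix (J k) (I k) ℝ) :
    Measurable fun Z : KArray I => tucker Z A := by
  unfold tucker
  fun_prop

/-- The mixed-product rule: a sum over multi-indices of products is the product of the sums over
each mode. -/
theorem tuckerMatrix_mul_transpose [∀ k, Fintype (I k)] (A : ∀ k, Matrix (J k) (I k) ℝ)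
    (B : ∀ k, Matrix (L k) (I k) ℝ) :
    tuckerMatrix A * (tuckerMatrix B).transpose =
      tuckerMatrix fun k => A k * (B k).transpose := by
  ext i j
  simp [tuckerMatrix, Matrix.mul_apply, Finset.prod_univ_sum, Finset.prod_mul_distrib]

end TuckerMatrix

/-! ### Moments of array normal laws. -/

section Moments

variable {ι : Type*} [Fintype ι]

theorem memLp_eval_pi_gaussianReal (i : ι) :
    MemLp (fun z : ι → ℝ => z i) 2 (Measure.pi fun _ => gaussianReal 0 1) :=
  (memLp_id_gaussianReal' 2 (by simp)).comp_measurePreserving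
    (measurePreserving_eval (fun _ : ι => gaussianReal 0 1) i)

theorem memLp_dotProduct_pi_gaussianReal (c : ι → ℝ) :
    MemLp (fun z : ι → ℝ => c ⬝ᵥ z) 2 (Measure.pi fun _ => gaussianReal 0 1) :=
  memLp_finsetSum _ fun j _ => (memLp_eval_pi_gaussianReal j).const_mul _

theorem integral_eval_pi_gaussianReal (i : ι) :
    ∫ z, z i ∂(Measure.pi fun _ : ι => gaussianReal 0 1) = 0 := by
  have h := integral_comp_eval (μ := fun _ : ι => gaussianReal 0 1) (i := i) (f := id)
    (by fun_prop)
  simpa only [id, integral_id_gaussianReal] using h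

theorem integral_dotProduct_pi_gaussianReal (c : ι → ℝ) :
    ∫ z, c ⬝ᵥ z ∂(Measure.pi fun _ : ι => gaussianReal 0 1) = 0 := by
  unfold dotProduct
  rw [integral_finsetSum _ fun j _ =>
    ((memLp_eval_pi_gaussianReal j).const_mul _).integrable (by norm_num)]
  simp [integral_const_mul, integral_eval_pi_gaussianReal]

theorem covariance_eval_pi_gaussianReal [DecidableEq ι] (i j : ι) :
    covariance (fun z : ι → ℝ => z i) (fun z => z j) (Measure.pi fun _ => gaussianReal 0 1) =
      if i = j then 1 else 0 := by
  split_ifs with h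
  · subst h
    rw [covariance_self (measurable_pi_apply i).aemeasurable]
    have hm := (measurePreserving_eval (fun _ : ι => gaussianReal 0 1) i)
    have hv := variance_map (X := id) (Y := Function.eval i)
      (μ := Measure.pi fun _ : ι => gaussianReal 0 1) (by fun_prop) (measurable_pi_apply i).aemeasurable
    rw [hm.map_eq, variance_id_gaussianReal] at hv
    exact hv.symm
  · exact ((iIndepFun_pi (μ := fun _ : ι => gaussianReal 0 1) (X := fun _ => id)
      (by fun_prop)).indepFun h).covariance_eq_zero
      (memLp_eval_pi_gaussianReal i) (memLp_eval_pi_gaussianReal j)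

theorem covariance_dotProduct_pi_gaussianReal (c d : ι → ℝ) :
    covariance (fun z : ι → ℝ => c ⬝ᵥ z) (fun z => d ⬝ᵥ z) (Measure.pi fun _ => gaussianReal 0 1) =
      c ⬝ᵥ d := by
  classical
  unfold dotProduct
  rw [covariance_fun_sum_fun_sum (fun j => (memLp_eval_pi_gaussianReal j).const_mul _)
    (fun j => (memLp_eval_pi_gaussianReal j).const_mul _)]
  simp [covariance_const_mul_left, covariance_const_mul_right, covariance_eval_pi_gaussianReal,
    mul_comm]

variable {K : ℕ} {I : Fin K → Type u} [∀ k, Fintype (I k)]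

instance : IsProbabilityMeasure (stdArrayNormal I) := by
  unfold stdArrayNormal
  infer_instance

theorem memLp_tucker (A : ∀ k, Matrix (I k) (I k) ℝ) (i : ∀ k, I k) :
    MemLp (fun Z : KArray I => tucker Z A i) 2 (stdArrayNormal I) :=
  memLp_dotProduct_pi_gaussianReal (tuckerMatrix A i)

variable [∀ k, DecidableEq (I k)] {ν : Measure (KArray I)} {M : KArray I}
  {S : ∀ k, Matrix (I k) (I k) ℝ}

theorem IsArrayNormal.memLp_eval (h : IsArrayNormal ν M S) (i : ∀ k, I k) :
    MemLp (fun x : KArray I => x i) 2 ν := by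
  obtain ⟨A, -, -, rfl⟩ := h
  rw [memLp_map_measure_iff (aestronglyMeasurable_eval _ i)
    ((measurable_tucker A).const_add M).aemeasurable]
  exact (memLp_const (M i)).add (memLp_tucker A i)

theorem IsArrayNormal.integral_eval (h : IsArrayNormal ν M S) (i : ∀ k, I k) :
    ∫ x, x i ∂ν = M i := by
  obtain ⟨A, -, -, rfl⟩ := h
  rw [integral_map ((measurable_tucker A).const_add M).aemeasurable
    (aestronglyMeasurable_eval _ i)]
  have h0 : ∫ Z, tucker Z A i ∂(stdArrayNormal I) = 0 :=
    integral_dotProduct_pi_gaussianReal (tuckerMatrix A i)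
  simp only [Pi.add_apply]
  rw [integral_add (integrable_const _) ((memLp_tucker A i).integrable (by norm_num)), h0]
  simp

theorem IsArrayNormal.covariance_eval (h : IsArrayNormal ν M S) (i j : ∀ k, I k) :
    covariance (fun x : KArray I => x i) (fun x => x j) ν = outerProd S i j := by
  obtain ⟨A, -, hS, rfl⟩ := h
  rw [covariance_map_fun (aestronglyMeasurable_eval _ i) (aestronglyMeasurable_eval _ j)
    ((measurable_tucker A).const_add M).aemeasurable]
  simp only [Pi.add_apply]
  rw [covariance_const_add_left ((memLp_tucker A i).integrable (by norm_num)),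
    covariance_const_add_right ((memLp_tucker A j).integrable (by norm_num))]
  refine (covariance_dotProduct_pi_gaussianReal (tuckerMatrix A i) (tuckerMatrix A j)).trans ?_
  refine (congrFun (congrFun (tuckerMatrix_mul_transpose A A) i) j).trans ?_
  simp only [← hS]
  rfl

end Moments

/-! ### Changing only the first mode. -/

section FirstMode

variable {K : ℕ} {I : Fin (K + 1) → Type u} {α β γ : Type u}

/-- The list `T, A 1, …, A K`, with `T` of arbitrary shape. -/
def consMatrix (T : Matrix β α ℝ) (A : ∀ k, Matrix (I k) (I k) ℝ) :
    ∀ k, Matrix (ReplaceFirst I β k) (ReplaceFirst I α k) ℝ :=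
  Fin.cons (α := fun k => Matrix (ReplaceFirst I β k) (ReplaceFirst I α k) ℝ) T fun k => A k.succ

/-- The list obtained from `A 0, …, A K` by keeping only the rows `a` of `A 0`. -/
def firstRows (a : Finset (I 0)) (A : ∀ k, Matrix (I k) (I k) ℝ) :
    ∀ k, Matrix (ReplaceFirst I a k) (I k) ℝ :=
  Fin.cons (α := fun k => Matrix (ReplaceFirst I a k) (I k) ℝ)
    ((A 0).submatrix Subtype.val id) fun k => A k.succ

theorem tuckerMatrix_consMatrix_apply (T : Matrix β α ℝ) (A : ∀ k, Matrix (I k) (I k) ℝ)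
    (i : ∀ k, ReplaceFirst I β k) (j : ∀ k, ReplaceFirst I α k) :
    tuckerMatrix (consMatrix T A) i j = T (i 0) (j 0) * ∏ k, A (Fin.succ k) (i k.succ) (j k.succ) :=
  Fin.prod_univ_succ _

/-- This carries the splitting of `S_[b,b]` into explained and residual parts over to the full
covariance. -/
theorem tuckerMatrix_consMatrix_add (T T' : Matrix β α ℝ) (A : ∀ k, Matrix (I k) (I k) ℝ) :
    tuckerMatrix (consMatrix (T + T') A) =
      tuckerMatrix (consMatrix T A) + tuckerMatrix (consMatrix T' A) := by
  ext i j
  rw [Matrix.add_apply, tuckerMatrix_consMatrix_apply, tuckerMatrix_consMatrix_apply,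
    tuckerMatrix_consMatrix_apply]
  exact add_mul _ _ _

theorem slice_tucker [∀ k, Fintype (I k)] (a : Finset (I 0)) (Z : KArray I)
    (A : ∀ k, Matrix (I k) (I k) ℝ) :
    slice a (tucker Z A) = tucker Z (firstRows a A) := by
  funext i
  refine Finset.sum_congr rfl fun j _ => ?_
  rw [Fin.prod_univ_succ, Fin.prod_univ_succ]
  rfl

theorem modeOneProd_tucker [∀ k, Fintype (I k)] [Fintype α] [Fintype β]
    (Z : KArray (ReplaceFirst I α)) (T : Matrix β α ℝ) (B : Matrix γ β ℝ)
    (A : ∀ k, Matrix (I k) (I k) ℝ) :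
    modeOneProd (tucker Z (consMatrix T A)) B = tucker Z (consMatrix (B * T) A) := by
  funext i
  simp only [tucker_eq_mulVec, modeOneProd, Matrix.mulVec, dotProduct,
    tuckerMatrix_consMatrix_apply, Finset.mul_sum]
  rw [Finset.sum_comm]
  refine Finset.sum_congr rfl fun j _ => ?_
  have h : ∀ (f g : β → ℝ) (p z : ℝ), ∑ x, f x * (g x * p * z) = (∑ x, f x * g x) * p * z := by
    intro f g p z
    simp only [Finset.sum_mul, mul_assoc]
  exact h (B (i 0)) (fun x => T x (j 0)) (∏ k, A (Fin.succ k) (i k.succ) (j k.succ)) (Z j)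

variable {A S : ∀ k, Matrix (I k) (I k) ℝ}

theorem consMatrix_mul_transpose [∀ k, Fintype (I k)] [Fintype α]
    (hS : ∀ k, S k = A k * (A k).transpose) (T : Matrix β α ℝ) (T' : Matrix γ α ℝ) :
    tuckerMatrix (consMatrix T A) * (tuckerMatrix (consMatrix T' A)).transpose =
      tuckerMatrix (consMatrix (T * T'.transpose) S) := by
  rw [tuckerMatrix_mul_transpose]
  congr 1
  funext k
  -- The types `ReplaceFirst I α k` reduce only once `k` is known to be zero or a successor.
  refine Fin.cases ?_ (fun k => ?_) k
  · rfl
  · exact (hS k.succ).symm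

theorem firstRows_mul_transpose [∀ k, Fintype (I k)]
    (hS : ∀ k, S k = A k * (A k).transpose) (a b : Finset (I 0)) :
    tuckerMatrix (firstRows a A) * (tuckerMatrix (firstRows b A)).transpose =
      tuckerMatrix (consMatrix (block (S 0) a b) S) := by
  rw [tuckerMatrix_mul_transpose]
  congr 1
  funext k
  refine Fin.cases ?_ (fun k => ?_) k
  · rw [hS 0, block_mul_transpose]
    rfl
  · exact (hS k.succ).symm

end FirstMode

/-! ### Conditioning in a model with independent noise. -/

/-- The kernel `x ↦ ρ.map (g x)` disintegrates the joint law, and disintegrations are almost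
everywhere unique. -/
theorem condDistrib_ae_eq_map_of_regression {Ω E F G H : Type*} [MeasurableSpace Ω]
    [MeasurableSpace E] [MeasurableSpace F] [StandardBorelSpace F] [Nonempty F]
    [MeasurableSpace G] [MeasurableSpace H] {P : Measure Ω} [IsFiniteMeasure P]
    {X : Ω → E} {Y : Ω → F} (hY : AEMeasurable Y P) {μ : Measure H} [IsFiniteMeasure μ]
    {ρ : Measure G} [IsProbabilityMeasure ρ] {f : H → E} (hf : Measurable f)
    {g : E → G → F} (hg : Measurable (Function.uncurry g))
    (h : P.map (fun ω => (X ω, Y ω)) = (μ.prod ρ).map fun p => (f p.1, g (f p.1) p.2)) :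
    ∀ᵐ x ∂(P.map X), condDistrib Y X P x = ρ.map (g x) := by
  let κ : Kernel E F := (Kernel.id ×ₖ Kernel.const E ρ).map (Function.uncurry g)
  have hκ : ∀ x, κ x = ρ.map (g x) := by
    intro x
    rw [Kernel.map_apply _ hg, Kernel.prod_apply, Kernel.id_apply, Kernel.const_apply,
      Measure.dirac_prod, Measure.map_map hg (by fun_prop)]
    rfl
  have : IsMarkovKernel κ := Kernel.IsMarkovKernel.map _ hg
  have hgf : Measurable fun p : H × G => (f p.1, g (f p.1) p.2) := by fun_prop
  have hmarg : P.map X = μ.map f := by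
    have h₁ := congrArg Measure.fst h
    rw [Measure.fst_map_prodMk₀ hY, Measure.fst_map_prodMk (by fun_prop)] at h₁
    have h₂ := Measure.map_map (μ := μ.prod ρ) hf measurable_fst
    rw [Measure.map_fst_prod, measure_univ, one_smul] at h₂
    rw [h₁, h₂]
    rfl
  have hκ' := condDistrib_ae_eq_of_measure_eq_compProd (μ := P) X hY (κ := κ) ?_
  · filter_upwards [hκ'] with x hx
    rw [hx, hκ]
  · rw [h, hmarg]
    -- By Fubini, both measures of `s` are integrals over `μ` of the `ρ`-measure of a section.
    ext s hs
    rw [Measure.map_apply hgf hs, Measure.compProd_apply hs, Measure.prod_apply (hgf hs),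
      lintegral_map (Kernel.measurable_kernel_prodMk_left hs) hf]
    refine lintegral_congr fun x => ?_
    rw [hκ, Measure.map_apply (by fun_prop) (measurable_prodMk_left hs)]
    rfl

/-! ### The regression model for slices, and the theorem. -/

section

variable {K : ℕ} {I : Fin (K + 1) → Type u}

theorem measurable_slice (a : Finset (I 0)) : Measurable fun Y : KArray I => slice a Y :=
  measurable_pi_lambda _ fun _ => measurable_pi_apply _

theorem measurable_condMean [DecidableEq (I 0)]
    (M : KArray I) (S : Matrix (I 0) (I 0) ℝ) (a b : Finset (I 0)) :
    Measurable (condMean M S a b) := by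
  refine Measurable.const_add (measurable_pi_lambda _ fun i => ?_) _
  unfold modeOneProd
  refine Finset.measurable_sum _ fun j _ => Measurable.const_mul ?_ _
  have h : Measurable fun y : KArray (ReplaceFirst I a) => y (replaceFirstIdx j i) :=
    measurable_pi_apply _
  exact h.sub_const _

variable [∀ k, Fintype (I k)]

theorem replaceFirstMatrix_eq_mul_transpose {α : Type u} [Fintype α]
    {C : Matrix α α ℝ} {T : Matrix α α ℝ} (hT : T = C * C.transpose)
    {A S : ∀ k, Matrix (I k) (I k) ℝ} (hS : ∀ k, S k = A k * (A k).transpose)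
    (k : Fin (K + 1)) :
    replaceFirstMatrix T S k = consMatrix C A k * (consMatrix C A k).transpose := by
  refine Fin.cases ?_ (fun k => ?_) k
  · exact hT
  · exact hS k.succ

variable [∀ k, DecidableEq (I k)]

theorem consMatrix_isUnit {α : Type u} [Fintype α] [DecidableEq α] {T : Matrix α α ℝ}
    (hT : IsUnit T) {A : ∀ k, Matrix (I k) (I k) ℝ} (hA : ∀ k, IsUnit (A k)) (k : Fin (K + 1)) :
    IsUnit (consMatrix T A k) := by
  refine Fin.cases ?_ (fun k => ?_) k
  · exact hT
  · exact hA k.succ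

theorem map_slice_eq_regression {A S : ∀ k, Matrix (I k) (I k) ℝ}
    (hA : ∀ k, IsUnit (A k)) (hS : ∀ k, S k = A k * (A k).transpose) (M : KArray I)
    (a b : Finset (I 0)) {T : Matrix a a ℝ} (hT : block (S 0) a a = T * T.transpose)
    {C : Matrix b b ℝ} (hC : condCov (S 0) a b = C * C.transpose) :
    (stdArrayNormal I).map (fun Z => (slice a (M + tucker Z A), slice b (M + tucker Z A))) =
      ((stdArrayNormal (ReplaceFirst I a)).prod (stdArrayNormal (ReplaceFirst I b))).map
        fun p => (slice a M + tucker p.1 (consMatrix T A),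
          condMean M (S 0) a b (slice a M + tucker p.1 (consMatrix T A)) +
            tucker p.2 (consMatrix C A)) := by
  have hpos : (S 0).PosDef := hS 0 ▸ Matrix.posDef_mul_transpose (hA 0)
  set B := block (S 0) b a * (block (S 0) a a)⁻¹ with hB
  -- The first-mode factor `B * T` gives the right cross-covariance, and `C` supplies the missing
  -- variance in `hbb`.
  have hreg : T * (B * T).transpose = block (S 0) a b := by
    rw [Matrix.transpose_mul, ← Matrix.mul_assoc, ← hT, block_mul_transpose_regression hpos]
  have hbb : block (S 0) b b = B * T * (B * T).transpose + C * C.transpose := by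
    rw [Matrix.mul_assoc, hreg, ← hC, condCov, ← hB, add_sub_cancel]
  have key : (stdArrayNormal I).map
        (fun Z => (tucker Z (firstRows a A), tucker Z (firstRows b A))) =
      ((stdArrayNormal (ReplaceFirst I a)).prod (stdArrayNormal (ReplaceFirst I b))).map
        fun p => (tucker p.1 (consMatrix T A),
          tucker p.1 (consMatrix (B * T) A) + tucker p.2 (consMatrix C A)) :=
    map_pi_gaussianReal_eq_regression (tuckerMatrix (firstRows a A))
    (tuckerMatrix (firstRows b A)) (tuckerMatrix (consMatrix T A))
    (tuckerMatrix (consMatrix (B * T) A)) (tuckerMatrix (consMatrix C A))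
    (by rw [firstRows_mul_transpose hS, consMatrix_mul_transpose hS, hT])
    (by rw [firstRows_mul_transpose hS, consMatrix_mul_transpose hS, hreg])
    (by rw [firstRows_mul_transpose hS, consMatrix_mul_transpose hS,
          consMatrix_mul_transpose hS, hbb, tuckerMatrix_consMatrix_add])
  have hmeas : Measurable fun p : KArray (ReplaceFirst I a) × KArray (ReplaceFirst I b) =>
      (tucker p.1 (consMatrix T A),
        tucker p.1 (consMatrix (B * T) A) + tucker p.2 (consMatrix C A)) :=
    ((measurable_tucker (consMatrix T A)).comp measurable_fst).prodMk
      (((measurable_tucker (consMatrix (B * T) A)).comp measurable_fst).add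
        ((measurable_tucker (consMatrix C A)).comp measurable_snd))
  -- The centred identity `key` is translated by the two mean slices.
  have hshift := congrArg (Measure.map fun q : KArray (ReplaceFirst I a) ×
    KArray (ReplaceFirst I b) => (slice a M + q.1, slice b M + q.2)) key
  rw [Measure.map_map (by fun_prop)
      ((measurable_tucker (firstRows a A)).prodMk (measurable_tucker (firstRows b A))),
    Measure.map_map (by fun_prop) hmeas] at hshift
  refine Eq.trans ?_ (hshift.trans ?_)
  · refine congrArg (fun f => Measure.map f _) (funext fun Z => ?_)
    exact Prod.ext (congrArg (slice a M + ·) (slice_tucker a Z A))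
      (congrArg (slice b M + ·) (slice_tucker b Z A))
  · refine congrArg (fun f => Measure.map f _) (funext fun p => Prod.ext rfl ?_)
    simp only [Function.comp_apply, condMean, add_sub_cancel_left, ← hB, modeOneProd_tucker]
    rw [add_assoc]

end

theorem mainTheorem3 {K : ℕ} {I : Fin (K + 1) → Type u}
    [∀ k, Fintype (I k)] [∀ k, DecidableEq (I k)]
    {Ω : Type*} [MeasurableSpace Ω] (P : Measure Ω) [IsProbabilityMeasure P]
    (Y : Ω → KArray I) (hY : AEMeasurable Y P)
    (M : KArray I) (S : ∀ k, Matrix (I k) (I k) ℝ)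
    (hlaw : IsArrayNormal (P.map Y) M S)
    (a b : Finset (I 0)) (hab : Disjoint a b) :
    ∀ᵐ y ∂(P.map fun ω => slice a (Y ω)),
      IsArrayNormal (condDistrib (fun ω => slice b (Y ω)) (fun ω => slice a (Y ω)) P y)
        (condMean M (S 0) a b y) (replaceFirstMatrix (condCov (S 0) a b) S) ∧
      (∀ i, MemLp (fun x : KArray (ReplaceFirst I b) => x i) 2
        (condDistrib (fun ω => slice b (Y ω)) (fun ω => slice a (Y ω)) P y)) ∧
      (∀ i, ∫ x, x i ∂(condDistrib (fun ω => slice b (Y ω)) (fun ω => slice a (Y ω)) P y) =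
        condMean M (S 0) a b y i) ∧
      (∀ i j, covariance (fun x : KArray (ReplaceFirst I b) => x i) (fun x => x j)
          (condDistrib (fun ω => slice b (Y ω)) (fun ω => slice a (Y ω)) P y) =
        outerProd (replaceFirstMatrix (condCov (S 0) a b) S) i j) := by
  obtain ⟨A, hA, hS, hPY⟩ := hlaw
  have hpos : (S 0).PosDef := hS 0 ▸ Matrix.posDef_mul_transpose (hA 0)
  obtain ⟨T, -, hT⟩ := (block_posDef hpos a).exists_isUnit_eq_mul_transpose
  obtain ⟨C, hCu, hC⟩ := (condCov_posDef hpos hab).exists_isUnit_eq_mul_transpose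
  have hYb : AEMeasurable (fun ω => slice b (Y ω)) P := (measurable_slice b).comp_aemeasurable hY
  have hMT := (measurable_tucker (consMatrix T A)).const_add (slice a M)
  have hg : Measurable (Function.uncurry fun (y : KArray (ReplaceFirst I a))
      (Z : KArray (ReplaceFirst I b)) => condMean M (S 0) a b y + tucker Z (consMatrix C A)) :=
    ((measurable_condMean M (S 0) a b).comp measurable_fst).add
      ((measurable_tucker (consMatrix C A)).comp measurable_snd)
  have hpair : P.map (fun ω => (slice a (Y ω), slice b (Y ω))) =
      ((stdArrayNormal (ReplaceFirst I a)).prod (stdArrayNormal (ReplaceFirst I b))).map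
        fun p => (slice a M + tucker p.1 (consMatrix T A),
          condMean M (S 0) a b (slice a M + tucker p.1 (consMatrix T A)) +
            tucker p.2 (consMatrix C A)) := by
    have hsl : Measurable fun W : KArray I => (slice a W, slice b W) :=
      (measurable_slice a).prodMk (measurable_slice b)
    rw [← map_slice_eq_regression hA hS M a b hT hC]
    refine (AEMeasurable.map_map_of_aemeasurable hsl.aemeasurable hY).symm.trans ?_
    rw [hPY, Measure.map_map hsl ((measurable_tucker A).const_add M)]
    rfl
  have hcond := condDistrib_ae_eq_map_of_regression hYb hMT hg hpair
  filter_upwards [hcond] with y hy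
  have hN : IsArrayNormal (condDistrib (fun ω => slice b (Y ω)) (fun ω => slice a (Y ω)) P y)
      (condMean M (S 0) a b y) (replaceFirstMatrix (condCov (S 0) a b) S) :=
    ⟨consMatrix C A, consMatrix_isUnit hCu hA, replaceFirstMatrix_eq_mul_transpose hC hS, hy⟩
  exact ⟨hN, hN.memLp_eval, hN.integral_eval, hN.covariance_eval⟩
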